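/- Let $M_d$ denote the complex $d\times d$ matrices, with standard matrix units $E_{ij}$. Every $S\in M_m\otimes M_n$ is uniquely of the form $S=\sum_{i,j=1}^m E_{ij}\otimes S_{ij}$ with blocks $S_{ij}\in M_n$; put $S_B=\operatorname{tr}_A S=\sum_{i=1}^m S_{ii}\in M_n$. Call a positive semidefinite $T\in M_m\otimes M_n$ separable if $T=\sum_{\gamma=1}^p A_\gamma\otimes B_\gamma$ for finitely many positive semidefinite $A_\gamma\in M_m$, $B_\gamma\in M_n$. For positive semidefinite $A$ with spectral decomposition $A=\sum_i\lambda_iP_i$ (all $\lambda_i>0$), let $A^\#=\sum_i\lambda_i^{-1}P_i$ be its Penrose pseudo-inverse. For positive semidefinite $T\in M_m\otimes M_n$ define the filtered matrix $$\widetilde T=\bigl(I\otimes((T_B)^\#)^{1/2}\bigr)\,T\,\bigl(I\otimes((T_B)^\#)^{1/2}\bigr).$$ **Theorem.** Let $T\in M_m\otimes M_n$ be positive semidefinite with $\operatorname{rank}T=\operatorname{rank}T_B$. Then $T$ is separable if and only if the matrices $(\widetilde T)_{ij}$, $1\le i,j\le m$, are all normal and mutually commute. -/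

import Mathlib

open scoped ComplexOrder MatrixOrder Kronecker

noncomputable section

/-- The algebra `M_m ⊗ M_n`, realised (through the Kronecker product) as the matrices indexed by
pairs; positive elements are positive semidefinite matrices. -/
abbrev BipartiteMatrix (m n : ℕ) : Type := Matrix (Fin m × Fin n) (Fin m × Fin n) ℂ

namespace BipartiteMatrix

variable {m n : ℕ}

/-- The blocks `S_ij ∈ M_n` of `S ∈ M_m ⊗ M_n`, that is, `S = ∑ i j, E_ij ⊗ S_ij`. -/
def block (S : BipartiteMatrix m n) (i j : Fin m) : Matrix (Fin n) (Fin n) ℂ :=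
  Matrix.of fun k l => S (i, k) (j, l)

theorem sum_single_kronecker_block (S : BipartiteMatrix m n) :
    ∑ i, ∑ j, Matrix.single i j (1 : ℂ) ⊗ₖ S.block i j = S := by
  ext ⟨a, b⟩ ⟨c, d⟩
  simp only [Matrix.sum_apply, Matrix.kroneckerMap_apply, Matrix.single_apply]
  rw [Finset.sum_eq_single a, Finset.sum_eq_single c] <;> simp +contextual [block]

/-- The marginal `T_B = tr_A T = ∑ i, T_ii ∈ M_n`. -/
def marginalB (T : BipartiteMatrix m n) : Matrix (Fin n) (Fin n) ℂ :=
  ∑ i, T.block i i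

/-- `T` is separable: `T = ∑ γ, A_γ ⊗ B_γ`, a finite sum with all `A_γ` and `B_γ` positive
semidefinite. -/
def IsSeparable (T : BipartiteMatrix m n) : Prop :=
  ∃ (p : ℕ) (A : Fin p → Matrix (Fin m) (Fin m) ℂ) (B : Fin p → Matrix (Fin n) (Fin n) ℂ),
    (∀ γ, (A γ).PosSemidef) ∧ (∀ γ, (B γ).PosSemidef) ∧ T = ∑ γ, A γ ⊗ₖ B γ

end BipartiteMatrix

/-- The Penrose pseudo-inverse `A^#` of a positive semidefinite matrix: if `A = ∑ i, λ_i P_i` is a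
spectral decomposition with all `λ_i > 0`, then `A^# = ∑ i, λ_i⁻¹ P_i`. In the functional calculus
this is `x ↦ x⁻¹` with the convention `0⁻¹ = 0`. -/
def pseudoInverse {n : ℕ} (A : Matrix (Fin n) (Fin n) ℂ) : Matrix (Fin n) (Fin n) ℂ :=
  cfc (fun x : ℝ => x⁻¹) A

/-- The filtered matrix `(I ⊗ ((T_B)^#)^{1/2}) T (I ⊗ ((T_B)^#)^{1/2})`. -/
def BipartiteMatrix.filtered {m n : ℕ} (T : BipartiteMatrix m n) : BipartiteMatrix m n :=
  ((1 : Matrix (Fin m) (Fin m) ℂ) ⊗ₖ CFC.sqrt (pseudoInverse T.marginalB)) * T *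
    ((1 : Matrix (Fin m) (Fin m) ℂ) ⊗ₖ CFC.sqrt (pseudoInverse T.marginalB))

end

open scoped Matrix

/-! Filtering preserves separability, does not raise the rank, and makes the marginal the support
projection P of `T_B`, of rank r = rank T. If the filtered matrix F is ∑ A_γ ⊗ B_γ, Cauchy–Schwarz
on its spectrum gives r² = (tr F)² ≤ r tr F², while tr F² = ∑ tr(A_γ A_δ) tr(B_γ B_δ) ≤ ∑ tr A_γ tr
A_δ tr(B_γ B_δ) = tr P² = r. Equality holds termwise: either B_γ B_δ = 0 or A_γ and A_δ are
proportional (`smul_mul_comm_of_rank_le`). Hence the blocks commute, and they are normal because the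
adjoint of a block is a block.

Conversely, commuting blocks share an orthonormal eigenbasis v_k, so F = ∑ A_k ⊗ v_k v_k*
(`isSeparable_of_commute_block`). Conjugating by I ⊗ `T_B`^{1/2} recovers T, since T lives on the
support of `T_B`. -/

/-! ### Traces, rank and positivity. -/

theorem Matrix.IsHermitian.trace_mul_self_eq_sum_eigenvalues {ι : Type*} [Fintype ι] [DecidableEq ι]
    {M : Matrix ι ι ℂ} (hM : M.IsHermitian) :
    (M * M).trace = ∑ i, ((hM.eigenvalues i ^ 2 : ℝ) : ℂ) := by
  conv_lhs => rw [hM.spectral_theorem, ← map_mul, Matrix.diagonal_mul_diagonal,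
    Unitary.conjStarAlgAut_apply, Matrix.trace_mul_comm, ← mul_assoc]
  simp [pow_two]

/-- Cauchy–Schwarz over the nonzero eigenvalues, whose number is the rank. -/
theorem Matrix.IsHermitian.re_trace_sq_le_rank_mul {ι : Type*} [Fintype ι] [DecidableEq ι]
    {M : Matrix ι ι ℂ} (hM : M.IsHermitian) :
    M.trace.re ^ 2 ≤ M.rank * (M * M).trace.re := by
  have h1 : M.trace.re = ∑ i, hM.eigenvalues i := by
    rw [hM.trace_eq_sum_eigenvalues]; simp
  have h2 : (M * M).trace.re = ∑ i, hM.eigenvalues i ^ 2 := by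
    rw [hM.trace_mul_self_eq_sum_eigenvalues]; simp only [Complex.re_sum, Complex.ofReal_re]
  rw [h1, h2, hM.rank_eq_card_non_zero_eigs, Fintype.card_subtype]
  have h3 : ∑ i, hM.eigenvalues i = ∑ i with hM.eigenvalues i ≠ 0, hM.eigenvalues i :=
    (Finset.sum_filter_ne_zero _).symm
  rw [h3]
  refine sq_sum_le_card_mul_sum_sq.trans (mul_le_mul_of_nonneg_left ?_ (Nat.cast_nonneg _))
  exact Finset.sum_le_sum_of_subset_of_nonneg (Finset.filter_subset _ _)
    fun i _ _ => sq_nonneg _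

theorem Matrix.re_trace_eq_rank_of_isIdempotentElem {ι : Type*} [Fintype ι]
    [DecidableEq ι] {P : Matrix ι ι ℂ} (h : IsIdempotentElem P) :
    P.trace.re = P.rank := by
  have hp : IsIdempotentElem (Matrix.toLin' P) := by
    rw [IsIdempotentElem, Module.End.mul_eq_comp, ← Matrix.toLin'_mul, h.eq]
  have := (LinearMap.IsProj.trace (LinearMap.IsIdempotentElem.isProj_range _ hp))
  rw [Matrix.trace_toLin'_eq] at this
  rw [this]
  rfl

theorem Matrix.IsHermitian.ofReal_re_trace {ι : Type*} [Fintype ι]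
    {M : Matrix ι ι ℂ} (hM : M.IsHermitian) : ((M.trace.re : ℝ) : ℂ) = M.trace := by
  rw [← Complex.conj_eq_iff_re, starRingEnd_apply, ← Matrix.trace_conjTranspose, hM.eq]

theorem Matrix.PosSemidef.trace_mul_nonneg {ι : Type*} [Fintype ι] [DecidableEq ι]
    {A B : Matrix ι ι ℂ} (hA : A.PosSemidef) (hB : B.PosSemidef) : 0 ≤ (A * B).trace := by
  obtain ⟨X, rfl⟩ := CStarAlgebra.nonneg_iff_eq_star_mul_self.mp hA.nonneg
  rw [mul_assoc, Matrix.trace_mul_comm]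
  exact (hB.mul_mul_conjTranspose_same X).trace_nonneg

/-- With A = X*X and B = Y*Y, the trace is the squared Hilbert–Schmidt norm of XY*. -/
theorem Matrix.PosSemidef.mul_eq_zero_of_trace_mul_eq_zero {ι : Type*} [Fintype ι] [DecidableEq ι]
    {A B : Matrix ι ι ℂ} (hA : A.PosSemidef) (hB : B.PosSemidef) (h : (A * B).trace = 0) :
    A * B = 0 := by
  obtain ⟨X, rfl⟩ := CStarAlgebra.nonneg_iff_eq_star_mul_self.mp hA.nonneg
  obtain ⟨Y, rfl⟩ := CStarAlgebra.nonneg_iff_eq_star_mul_self.mp hB.nonneg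
  simp only [Matrix.star_eq_conjTranspose] at *
  have h0 : X * Yᴴ = 0 := by
    rw [← Matrix.trace_mul_conjTranspose_self_eq_zero_iff, ← h, Matrix.conjTranspose_mul,
      Matrix.conjTranspose_conjTranspose, mul_assoc Xᴴ, Matrix.trace_mul_comm Xᴴ]
    simp only [mul_assoc]
  rw [mul_assoc, ← mul_assoc X, h0, zero_mul, mul_zero]

theorem Matrix.PosSemidef.re_trace_mul_self_le {ι : Type*} [Fintype ι] [DecidableEq ι]
    {A : Matrix ι ι ℂ} (hA : A.PosSemidef) : (A * A).trace.re ≤ A.trace.re ^ 2 := by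
  have h1 : A.trace.re = ∑ i, hA.1.eigenvalues i := by
    rw [hA.1.trace_eq_sum_eigenvalues]; simp
  have h2 : (A * A).trace.re = ∑ i, hA.1.eigenvalues i ^ 2 := by
    rw [hA.1.trace_mul_self_eq_sum_eigenvalues]; simp only [Complex.re_sum, Complex.ofReal_re]
  rw [h1, h2]
  exact Finset.sum_sq_le_sq_sum_of_nonneg fun i _ => hA.eigenvalues_nonneg i

/-- The functional calculus behind filtering: `R = (A^#)^{1/2}`, `S = A^{1/2}` and the support
projection `P` of `A`. -/
theorem exists_filter_data {n : ℕ} {A : Matrix (Fin n) (Fin n) ℂ} (hA : A.PosSemidef) :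
    ∃ R S P : Matrix (Fin n) (Fin n) ℂ, CFC.sqrt (pseudoInverse A) = R ∧ R.IsHermitian ∧
      S.IsHermitian ∧ P.IsHermitian ∧ IsIdempotentElem P ∧ R * A * R = P ∧ S * R = P ∧ R * S = P ∧
      A * P = A := by
  have hsa : IsSelfAdjoint A := hA.1
  have hc (f : ℝ → ℝ) : ContinuousOn f (spectrum ℝ A) :=
    (Matrix.finite_real_spectrum (A := A)).continuousOn f
  have hs {x : ℝ} (hx : x ∈ spectrum ℝ A) : 0 ≤ x := spectrum_nonneg_of_nonneg hA.nonneg hx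
  have hR : CFC.sqrt (pseudoInverse A) = cfc (fun x : ℝ => Real.sqrt x⁻¹) A := by
    refine CFC.sqrt_unique ?_ (cfc_nonneg fun x _ => Real.sqrt_nonneg _)
    rw [← cfc_mul _ _ A (hc _) (hc _), pseudoInverse]
    exact cfc_congr fun x hx => Real.mul_self_sqrt (inv_nonneg.2 (hs hx))
  have hid : cfc (fun x : ℝ => x) A = A := cfc_id' ℝ A
  -- As 0⁻¹ = 0, the function x * x⁻¹ is the indicator of x ≠ 0.
  refine ⟨_, cfc Real.sqrt A, cfc (fun x : ℝ => x * x⁻¹) A, hR, cfc_predicate _ A,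
    cfc_predicate _ A, cfc_predicate _ A, ?_, ?_, ?_, ?_, ?_⟩
  · rw [IsIdempotentElem, ← cfc_mul _ _ A (hc _) (hc _)]
    refine cfc_congr fun x hx => ?_
    by_cases h : x = 0 <;> simp [h]
  · nth_rw 2 [← hid]
    rw [← cfc_mul _ _ A (hc _) (hc _), ← cfc_mul _ _ A (hc _) (hc _)]
    refine cfc_congr fun x hx => ?_
    have := Real.mul_self_sqrt (inv_nonneg.2 (hs hx))
    linear_combination x * this
  · rw [← cfc_mul _ _ A (hc _) (hc _)]
    refine cfc_congr fun x hx => ?_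
    rw [← Real.sqrt_mul (hs hx)]
    by_cases h : x = 0 <;> simp [h]
  · rw [← cfc_mul _ _ A (hc _) (hc _)]
    refine cfc_congr fun x hx => ?_
    rw [mul_comm, ← Real.sqrt_mul (hs hx)]
    by_cases h : x = 0 <;> simp [h]
  · nth_rw 1 3 [← hid]
    rw [← cfc_mul _ _ A (hc _) (hc _)]
    refine cfc_congr fun x hx => ?_
    by_cases h : x = 0 <;> simp [h]

/-! ### Blocks, marginals and local conjugation. -/

namespace BipartiteMatrix

variable {m n : ℕ}

theorem block_one_kronecker_mul_mul (T : BipartiteMatrix m n) (X Y : Matrix (Fin n) (Fin n) ℂ)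
    (i j : Fin m) :
    block (((1 : Matrix (Fin m) (Fin m) ℂ) ⊗ₖ X) * T * ((1 : Matrix (Fin m) (Fin m) ℂ) ⊗ₖ Y)) i j =
      X * T.block i j * Y := by
  ext k l
  simp [block, Matrix.mul_apply, Fintype.sum_prod_type, Matrix.one_apply, ite_mul, Finset.sum_mul]

theorem marginalB_one_kronecker_mul_mul (T : BipartiteMatrix m n)
    (X Y : Matrix (Fin n) (Fin n) ℂ) :
    marginalB (((1 : Matrix (Fin m) (Fin m) ℂ) ⊗ₖ X) * T * ((1 : Matrix (Fin m) (Fin m) ℂ) ⊗ₖ Y)) =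
      X * T.marginalB * Y := by
  simp only [marginalB, block_one_kronecker_mul_mul, Finset.mul_sum, Finset.sum_mul]

theorem trace_marginalB (T : BipartiteMatrix m n) : T.marginalB.trace = T.trace := by
  simp [marginalB, block, Matrix.trace, Fintype.sum_prod_type, Matrix.sum_apply]
  rw [Finset.sum_comm]

theorem block_conjTranspose {T : BipartiteMatrix m n} (hT : T.IsHermitian) (i j : Fin m) :
    (T.block i j)ᴴ = T.block j i := by
  ext k l
  exact hT.apply _ _

theorem posSemidef_block_self {T : BipartiteMatrix m n} (hT : T.PosSemidef) (i : Fin m) :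
    (T.block i i).PosSemidef :=
  hT.submatrix fun k => (i, k)

theorem posSemidef_marginalB {T : BipartiteMatrix m n} (hT : T.PosSemidef) :
    T.marginalB.PosSemidef :=
  Matrix.posSemidef_sum _ fun i _ => posSemidef_block_self hT i

theorem block_sum_kronecker {ι : Type*} [Fintype ι] (A : ι → Matrix (Fin m) (Fin m) ℂ)
    (B : ι → Matrix (Fin n) (Fin n) ℂ) (i j : Fin m) :
    block (∑ γ, A γ ⊗ₖ B γ) i j = ∑ γ, A γ i j • B γ := by
  ext k l
  simp [block, Matrix.sum_apply]

theorem marginalB_sum_kronecker {ι : Type*} [Fintype ι] (A : ι → Matrix (Fin m) (Fin m) ℂ)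
    (B : ι → Matrix (Fin n) (Fin n) ℂ) :
    marginalB (∑ γ, A γ ⊗ₖ B γ) = ∑ γ, (A γ).trace • B γ := by
  simp only [marginalB, block_sum_kronecker]
  rw [Finset.sum_comm]
  simp only [Matrix.trace, Matrix.diag_apply, Finset.sum_smul]

theorem IsSeparable.one_kronecker_mul_mul {T : BipartiteMatrix m n} (hT : T.IsSeparable)
    (X : Matrix (Fin n) (Fin n) ℂ) :
    IsSeparable (((1 : Matrix (Fin m) (Fin m) ℂ) ⊗ₖ X) * T *
      ((1 : Matrix (Fin m) (Fin m) ℂ) ⊗ₖ Xᴴ)) := by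
  obtain ⟨p, A, B, hA, hB, rfl⟩ := hT
  refine ⟨p, A, fun γ => X * B γ * Xᴴ, hA, fun γ => (hB γ).mul_mul_conjTranspose_same X, ?_⟩
  simp only [Finset.mul_sum, Finset.sum_mul, ← Matrix.mul_kronecker_mul, one_mul, mul_one]

/-- `T` is supported on the support of its marginal. -/
theorem mul_one_kronecker_eq_self {T : BipartiteMatrix m n} (hT : T.PosSemidef)
    {P : Matrix (Fin n) (Fin n) ℂ} (hP : P.IsHermitian) (h : T.marginalB * P = T.marginalB) :
    T * ((1 : Matrix (Fin m) (Fin m) ℂ) ⊗ₖ P) = T := by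
  set Q : Matrix (Fin n) (Fin n) ℂ := 1 - P with hQ
  have hQH : Qᴴ = Q := by simp [hQ, hP.eq]
  set W := (1 : Matrix (Fin m) (Fin m) ℂ) ⊗ₖ Q with hW
  have hWH : Wᴴ = W := by rw [hW, Matrix.conjTranspose_kronecker, hQH, Matrix.conjTranspose_one]
  -- This trace is that of Q `T_B` Q = 0; writing T = X*X, it is also the squared norm of XW.
  have htr : (W * T * W).trace = 0 := by
    rw [← trace_marginalB, hW, marginalB_one_kronecker_mul_mul, mul_assoc, hQ, mul_sub, h]
    simp
  obtain ⟨X, rfl⟩ := CStarAlgebra.nonneg_iff_eq_star_mul_self.mp hT.nonneg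
  have hX : X * W = 0 := by
    rw [← Matrix.trace_conjTranspose_mul_self_eq_zero_iff, ← htr, Matrix.conjTranspose_mul, hWH,
      Matrix.star_eq_conjTranspose]
    simp only [mul_assoc]
  have hPW : (1 : Matrix (Fin m) (Fin m) ℂ) ⊗ₖ P = 1 - W := by
    rw [eq_sub_iff_add_eq, hW, ← Matrix.kronecker_add, hQ, add_sub_cancel, Matrix.one_kronecker_one]
  rw [hPW, mul_sub, mul_one, mul_assoc, hX, mul_zero, sub_zero]

end BipartiteMatrix

/-! ### The inequality tr(AB) ≤ tr A tr B and its equality case. -/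

/-- For positive semidefinite `A` and `B`, the square of the Hilbert-Schmidt norm of
`(tr B) A - (tr A) B` bounds the defect in `tr (A B) ≤ tr A tr B`. -/
theorem Matrix.PosSemidef.re_trace_sq_smul_sub_smul_le {ι : Type*} [Fintype ι] [DecidableEq ι]
    {A B : Matrix ι ι ℂ} (hA : A.PosSemidef) (hB : B.PosSemidef) :
    ((B.trace • A - A.trace • B) * (B.trace • A - A.trace • B)).trace.re ≤
      2 * (A.trace.re * B.trace.re) * (A.trace.re * B.trace.re - (A * B).trace.re) := by
  have h1 := hA.re_trace_mul_self_le
  have h2 := hB.re_trace_mul_self_le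
  rw [← hA.1.ofReal_re_trace, ← hB.1.ofReal_re_trace]
  simp only [sub_mul, mul_sub, Matrix.trace_sub, smul_mul_assoc, mul_smul_comm, Matrix.trace_smul,
    Matrix.trace_mul_comm B A, smul_eq_mul, Complex.sub_re, Complex.re_ofReal_mul, Complex.ofReal_re]
  -- With a = tr A and b = tr B, the left side is b² tr A² + a² tr B² - 2ab tr(AB), where tr A² ≤ a²
  -- and tr B² ≤ b².
  nlinarith [mul_le_mul_of_nonneg_left h1 (sq_nonneg B.trace.re),
    mul_le_mul_of_nonneg_left h2 (sq_nonneg A.trace.re)]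

theorem Matrix.PosSemidef.isHermitian_smul_sub_smul {ι : Type*} [Fintype ι]
    {A B : Matrix ι ι ℂ} (hA : A.PosSemidef) (hB : B.PosSemidef) :
    (B.trace • A - A.trace • B).IsHermitian := by
  have h1 := Matrix.trace_conjTranspose A
  have h2 := Matrix.trace_conjTranspose B
  rw [hA.1.eq] at h1
  rw [hB.1.eq] at h2
  rw [Matrix.IsHermitian, Matrix.conjTranspose_sub, Matrix.conjTranspose_smul,
    Matrix.conjTranspose_smul, hA.1.eq, hB.1.eq, ← h1, ← h2]

theorem Matrix.IsHermitian.re_trace_mul_self_nonneg {ι : Type*} [Fintype ι] [DecidableEq ι]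
    {D : Matrix ι ι ℂ} (hD : D.IsHermitian) : 0 ≤ (D * D).trace.re := by
  have := (Matrix.posSemidef_conjTranspose_mul_self D).trace_nonneg
  rw [hD.eq] at this
  exact (Complex.le_def.1 this).1

theorem Matrix.PosSemidef.re_trace_mul_le {ι : Type*} [Fintype ι] [DecidableEq ι]
    {A B : Matrix ι ι ℂ} (hA : A.PosSemidef) (hB : B.PosSemidef) :
    (A * B).trace.re ≤ A.trace.re * B.trace.re := by
  have ha : 0 ≤ A.trace.re := (Complex.le_def.1 hA.trace_nonneg).1
  have hb : 0 ≤ B.trace.re := (Complex.le_def.1 hB.trace_nonneg).1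
  have h := (hA.isHermitian_smul_sub_smul hB).re_trace_mul_self_nonneg.trans
    (hA.re_trace_sq_smul_sub_smul_le hB)
  rcases ha.eq_or_lt with h0 | h0
  · have : A = 0 := hA.trace_eq_zero_iff.1 (by rw [← hA.1.ofReal_re_trace, ← h0]; simp)
    simp [this]
  rcases hb.eq_or_lt with h1 | h1
  · have : B = 0 := hB.trace_eq_zero_iff.1 (by rw [← hB.1.ofReal_re_trace, ← h1]; simp)
    simp [this]
  exact sub_nonneg.1 (nonneg_of_mul_nonneg_right h (by positivity))

theorem Matrix.PosSemidef.smul_eq_smul_of_re_trace_mul_eq {ι : Type*} [Fintype ι] [DecidableEq ι]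
    {A B : Matrix ι ι ℂ} (hA : A.PosSemidef) (hB : B.PosSemidef)
    (h : (A * B).trace.re = A.trace.re * B.trace.re) : B.trace • A = A.trace • B := by
  have hD := hA.isHermitian_smul_sub_smul hB
  have hle := hA.re_trace_sq_smul_sub_smul_le hB
  rw [h, sub_self, mul_zero] at hle
  rw [← sub_eq_zero, ← Matrix.trace_conjTranspose_mul_self_eq_zero_iff, hD.eq]
  have hDD : ((B.trace • A - A.trace • B) * (B.trace • A - A.trace • B)).IsHermitian := by
    rw [Matrix.IsHermitian, Matrix.conjTranspose_mul, hD.eq]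
  rw [← hDD.ofReal_re_trace, le_antisymm hle hD.re_trace_mul_self_nonneg, Complex.ofReal_zero]

/-- Positive semidefinite matrices for which `tr (A B) = tr A tr B` are proportional. -/
theorem Matrix.PosSemidef.mul_apply_comm_of_re_trace_mul_eq {ι : Type*} [Fintype ι] [DecidableEq ι]
    {A B : Matrix ι ι ℂ} (hA : A.PosSemidef) (hB : B.PosSemidef)
    (h : (A * B).trace.re = A.trace.re * B.trace.re) (i j k l : ι) :
    A i j * B k l = A k l * B i j := by
  by_cases hA0 : A.trace = 0
  · simp [hA.trace_eq_zero_iff.1 hA0]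
  have hs := hA.smul_eq_smul_of_re_trace_mul_eq hB h
  have e1 : B.trace * A i j = A.trace * B i j := congrFun (congrFun hs i) j
  have e2 : B.trace * A k l = A.trace * B k l := congrFun (congrFun hs k) l
  refine mul_left_cancel₀ hA0 ?_
  linear_combination A k l * e1 - A i j * e2

/-! ### From separability to commuting blocks. -/

namespace BipartiteMatrix

/-- A separable decomposition of a matrix whose marginal is a projection of at least the same
rank: factors `A γ` and `A δ` whose partners are not orthogonal are proportional. -/
theorem smul_mul_comm_of_rank_le {m n : ℕ} {ι : Type*} [Fintype ι]
    {A : ι → Matrix (Fin m) (Fin m) ℂ} {B : ι → Matrix (Fin n) (Fin n) ℂ}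
    (hA : ∀ γ, (A γ).PosSemidef) (hB : ∀ γ, (B γ).PosSemidef)
    (hP : IsIdempotentElem (marginalB (∑ γ, A γ ⊗ₖ B γ)))
    (hrank : (∑ γ, A γ ⊗ₖ B γ).rank ≤ (marginalB (∑ γ, A γ ⊗ₖ B γ)).rank)
    (γ δ : ι) (i j k l : Fin m) :
    (A γ i j * A δ k l) • (B γ * B δ) = (A γ k l * A δ i j) • (B γ * B δ) := by
  set T : BipartiteMatrix m n := ∑ γ, A γ ⊗ₖ B γ with hT
  have hTpos : T.PosSemidef := Matrix.posSemidef_sum _ fun γ _ => (hA γ).kronecker (hB γ)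
  have hpq (γ δ : ι) : (A γ * A δ).trace.re * (B γ * B δ).trace.re ≤
      (A γ).trace.re * (A δ).trace.re * (B γ * B δ).trace.re :=
    mul_le_mul_of_nonneg_right ((hA γ).re_trace_mul_le (hA δ))
      (Complex.le_def.1 ((hB γ).trace_mul_nonneg (hB δ))).1
  have him {ι : Type} [Fintype ι] [DecidableEq ι] {X Y : Matrix ι ι ℂ} (hX : X.PosSemidef)
      (hY : Y.PosSemidef) : (X * Y).trace = (((X * Y).trace.re : ℝ) : ℂ) :=
    Complex.eq_re_of_ofReal_le (hX.trace_mul_nonneg hY)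
  have hTT : (T * T).trace.re = ∑ γ, ∑ δ, (A γ * A δ).trace.re * (B γ * B δ).trace.re := by
    simp only [hT, Finset.sum_mul_sum, ← Matrix.mul_kronecker_mul, Matrix.trace_sum,
      Matrix.trace_kronecker, Complex.re_sum]
    refine Finset.sum_congr rfl fun γ _ => Finset.sum_congr rfl fun δ _ => ?_
    rw [him (hA γ) (hA δ), Complex.re_ofReal_mul, Complex.ofReal_re]
  have hPP : T.marginalB.trace.re =
      ∑ γ, ∑ δ, (A γ).trace.re * (A δ).trace.re * (B γ * B δ).trace.re := by
    rw [← hP.eq, hT, marginalB_sum_kronecker]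
    simp only [Finset.sum_mul_sum, Matrix.trace_sum, smul_mul_assoc, mul_smul_comm,
      Matrix.trace_smul, smul_eq_mul, Complex.re_sum]
    refine Finset.sum_congr rfl fun γ _ => Finset.sum_congr rfl fun δ _ => ?_
    rw [← (hA γ).1.ofReal_re_trace, ← (hA δ).1.ofReal_re_trace, Complex.re_ofReal_mul,
      Complex.re_ofReal_mul, Complex.ofReal_re, Complex.ofReal_re]
    ring
  have hr : T.marginalB.trace.re = T.marginalB.rank :=
    Matrix.re_trace_eq_rank_of_isIdempotentElem hP
  have hge : T.marginalB.trace.re ≤ (T * T).trace.re := by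
    have hcs := hTpos.1.re_trace_sq_le_rank_mul
    have hnn := hTpos.1.re_trace_mul_self_nonneg
    rw [← trace_marginalB, hr] at hcs
    rw [hr]
    have hcast : (T.rank : ℝ) ≤ T.marginalB.rank := by exact_mod_cast hrank
    -- Cauchy–Schwarz gives r² ≤ r tr T²; cancelling r needs r > 0.
    rcases (Nat.cast_nonneg (α := ℝ) T.marginalB.rank).eq_or_lt with h0 | h0
    · rw [← h0]; exact hnn
    · refine le_of_mul_le_mul_left ?_ h0
      rw [← pow_two]
      exact hcs.trans (mul_le_mul_of_nonneg_right hcast hnn)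
  rw [hTT, hPP] at hge
  -- The termwise bounds `hpq` have equal sums, so each is an equality.
  have hsum := le_antisymm (Finset.sum_le_sum fun γ _ => Finset.sum_le_sum fun δ _ => hpq γ δ) hge
  have heq := (Finset.sum_eq_sum_iff_of_le fun δ _ => hpq γ δ).1
    ((Finset.sum_eq_sum_iff_of_le fun γ _ => Finset.sum_le_sum fun δ _ => hpq γ δ).1 hsum γ
      (Finset.mem_univ _)) δ (Finset.mem_univ _)
  by_cases h0 : (B γ * B δ).trace.re = 0
  · have : B γ * B δ = 0 := (hB γ).mul_eq_zero_of_trace_mul_eq_zero (hB δ) (by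
      rw [him (hB γ) (hB δ), h0, Complex.ofReal_zero])
    simp [this]
  · rw [(hA γ).mul_apply_comm_of_re_trace_mul_eq (hA δ) (mul_right_cancel₀ h0 heq)]

theorem commute_block_of_rank_le {m n : ℕ} {T : BipartiteMatrix m n} (hT : T.IsSeparable)
    (hP : IsIdempotentElem T.marginalB) (hrank : T.rank ≤ T.marginalB.rank) (i j k l : Fin m) :
    Commute (T.block i j) (T.block k l) := by
  obtain ⟨p, A, B, hA, hB, rfl⟩ := hT
  simp only [Commute, SemiconjBy, block_sum_kronecker, Finset.sum_mul_sum, smul_mul_smul_comm]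
  exact Finset.sum_congr rfl fun γ _ => Finset.sum_congr rfl fun δ _ =>
    smul_mul_comm_of_rank_le hA hB hP hrank γ δ i j k l

theorem isStarNormal_block_of_commute {m n : ℕ} {T : BipartiteMatrix m n} (hT : T.IsHermitian)
    (h : ∀ i j k l, Commute (T.block i j) (T.block k l)) (i j : Fin m) :
    IsStarNormal (T.block i j) := by
  refine ⟨?_⟩
  rw [Matrix.star_eq_conjTranspose, block_conjTranspose hT]
  exact h _ _ _ _

end BipartiteMatrix

/-! ### Simultaneous diagonalisation. -/

/-- An orthogonal decomposition of a finite-dimensional space, over any index type, has an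
orthonormal basis subordinate to it. -/
theorem DirectSum.IsInternal.exists_orthonormalBasis_mem {E ι : Type*} [NormedAddCommGroup E]
    [InnerProductSpace ℂ E] [FiniteDimensional ℂ E] [DecidableEq ι] {V : ι → Submodule ℂ E}
    (hV : DirectSum.IsInternal V)
    (hO : OrthogonalFamily ℂ (fun i => V i) fun i => (V i).subtypeₗᵢ) {n : ℕ}
    (hn : Module.finrank ℂ E = n) :
    ∃ v : OrthonormalBasis (Fin n) ℂ E, ∀ k, ∃ i, v k ∈ V i := by
  classical
  -- Joint eigenspaces are indexed by all functions κ → ℂ, but only finitely many are nonzero.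
  have hfin : {i | V i ≠ ⊥}.Finite :=
    WellFoundedGT.finite_ne_bot_of_iSupIndep hV.submodule_iSupIndep
  let _ : Fintype {i // V i ≠ ⊥} := hfin.fintype
  have hV' : DirectSum.IsInternal fun i : {i // V i ≠ ⊥} => V i :=
    DirectSum.isInternal_ne_bot_iff.2 hV
  have hO' : OrthogonalFamily ℂ (fun i : {i // V i ≠ ⊥} => V i) fun i => (V i).subtypeₗᵢ :=
    hO.comp Subtype.val_injective
  exact ⟨hV'.subordinateOrthonormalBasis hn hO', fun k =>
    ⟨_, hV'.subordinateOrthonormalBasis_subordinate hn k hO'⟩⟩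

/-- Commuting Hermitian matrices have a common orthonormal eigenbasis. -/
theorem Matrix.exists_orthonormalBasis_mulVec_eq_smul_of_isHermitian {n : ℕ} {κ : Type*}
    {H : κ → Matrix (Fin n) (Fin n) ℂ} (hH : ∀ a, (H a).IsHermitian)
    (hc : ∀ a b, Commute (H a) (H b)) :
    ∃ v : OrthonormalBasis (Fin n) ℂ (EuclideanSpace ℂ (Fin n)),
      ∀ a k, ∃ c : ℂ, H a *ᵥ (v k).ofLp = c • (v k).ofLp := by
  classical
  set L : κ → Module.End ℂ (EuclideanSpace ℂ (Fin n)) := fun a => Matrix.toEuclideanLin (H a)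
  have hs (a : κ) : (L a).IsSymmetric := Matrix.isSymmetric_toEuclideanLin_iff.2 (hH a)
  have hC : Pairwise (Function.onFun Commute L) := fun a b _ => by
    refine LinearMap.ext fun x => ?_
    apply WithLp.ofLp_injective
    simp only [L, Module.End.mul_apply, Matrix.ofLp_toLpLin, Matrix.toLin'_apply, Matrix.mulVec_mulVec,
      (hc a b).eq]
  have hI := LinearMap.IsSymmetric.directSum_isInternal_of_pairwise_commute hs hC
  have hO := LinearMap.IsSymmetric.orthogonalFamily_iInf_eigenspaces hs
  obtain ⟨v, hv⟩ := hI.exists_orthonormalBasis_mem hO finrank_euclideanSpace_fin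
  refine ⟨v, fun a k => ?_⟩
  obtain ⟨γ, hk⟩ := hv k
  have := Module.End.mem_eigenspace_iff.1 ((Submodule.mem_iInf _).1 hk a)
  exact ⟨γ a, congrArg WithLp.ofLp this⟩

theorem OrthonormalBasis.sum_vecMulVec_star {n : ℕ}
    (v : OrthonormalBasis (Fin n) ℂ (EuclideanSpace ℂ (Fin n))) :
    ∑ k, Matrix.vecMulVec (v k).ofLp (star (v k).ofLp) = 1 := by
  refine Matrix.ext_of_mulVec_single fun a => ?_
  have h := congrArg WithLp.ofLp (v.sum_repr' (WithLp.toLp 2 (Pi.single a 1)))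
  rw [Matrix.one_mulVec]
  refine Eq.trans ?_ h
  rw [Matrix.sum_mulVec, WithLp.ofLp_sum]
  refine Finset.sum_congr rfl fun k _ => ?_
  rw [Matrix.vecMulVec_mulVec, WithLp.ofLp_smul, EuclideanSpace.inner_eq_star_dotProduct,
    dotProduct_comm]
  simp

theorem Matrix.eq_sum_smul_vecMulVec_of_mulVec_eq {n : ℕ}
    (v : OrthonormalBasis (Fin n) ℂ (EuclideanSpace ℂ (Fin n)))
    {X : Matrix (Fin n) (Fin n) ℂ} {c : Fin n → ℂ}
    (h : ∀ k, X *ᵥ (v k).ofLp = c k • (v k).ofLp) :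
    X = ∑ k, c k • Matrix.vecMulVec (v k).ofLp (star (v k).ofLp) := by
  conv_lhs => rw [← mul_one X, ← v.sum_vecMulVec_star, Finset.mul_sum]
  refine Finset.sum_congr rfl fun k _ => ?_
  rw [Matrix.mul_vecMulVec, h, Matrix.smul_vecMulVec]

/-! ### From commuting blocks to separability. -/

namespace BipartiteMatrix

variable {m n : ℕ}

/-- The compression of `T` to a vector in the second factor. -/
theorem posSemidef_dotProduct_block_mulVec {T : BipartiteMatrix m n} (hT : T.PosSemidef)
    (v : Fin n → ℂ) :
    (Matrix.of fun i j => star v ⬝ᵥ (T.block i j *ᵥ v)).PosSemidef := by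
  have := hT.conjTranspose_mul_mul_same
    -- This is I ⊗ v, with v as a column.
    (Matrix.of fun (p : Fin m × Fin n) (j : Fin m) => if p.1 = j then v p.2 else 0)
  convert this using 1
  ext i j
  simp [block, Matrix.mul_apply, Fintype.sum_prod_type, dotProduct, Matrix.mulVec, Finset.mul_sum,
    Finset.sum_mul, apply_ite, ite_mul]
  rw [Finset.sum_comm]
  simp [mul_assoc]

theorem isSeparable_of_commute_block {T : BipartiteMatrix m n} (hT : T.PosSemidef)
    (h : ∀ i j k l, Commute (T.block i j) (T.block k l)) : T.IsSeparable := by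
  have hstar := block_conjTranspose hT.1
  obtain ⟨v, hv⟩ := Matrix.exists_orthonormalBasis_mulVec_eq_smul_of_isHermitian
    -- X + X* and i(X - X*) for each block X; eigenvalues c and d of these give X the eigenvalue (c
    -- - id)/2.
    (H := Sum.elim (fun p : Fin m × Fin m => T.block p.1 p.2 + T.block p.2 p.1)
      fun p : Fin m × Fin m => Complex.I • (T.block p.1 p.2 - T.block p.2 p.1))
    (by
      rintro (p | p)
      · simp [Matrix.IsHermitian, hstar, add_comm]
      · simp [Matrix.IsHermitian, hstar, ← smul_neg])
    (by
      rintro (p | p) (q | q)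
      · exact ((h _ _ _ _).add_right (h _ _ _ _)).add_left ((h _ _ _ _).add_right (h _ _ _ _))
      · exact (((h _ _ _ _).sub_right (h _ _ _ _)).add_left
          ((h _ _ _ _).sub_right (h _ _ _ _))).smul_right _
      · exact (((h _ _ _ _).add_right (h _ _ _ _)).sub_left
          ((h _ _ _ _).add_right (h _ _ _ _))).smul_left _
      · exact ((((h _ _ _ _).sub_right (h _ _ _ _)).sub_left
          ((h _ _ _ _).sub_right (h _ _ _ _))).smul_left _).smul_right _)
  have heig (i j : Fin m) (k : Fin n) :
      T.block i j *ᵥ (v k).ofLp =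
        (star (v k).ofLp ⬝ᵥ (T.block i j *ᵥ (v k).ofLp)) • (v k).ofLp := by
    obtain ⟨c, hc⟩ := hv (Sum.inl (i, j)) k
    obtain ⟨d, hd⟩ := hv (Sum.inr (i, j)) k
    simp only [Sum.elim_inl, Sum.elim_inr, Matrix.smul_mulVec, Matrix.add_mulVec,
      Matrix.sub_mulVec] at hc hd
    have he : T.block i j *ᵥ (v k).ofLp = ((c - Complex.I * d) / 2) • (v k).ofLp := by
      ext a
      have hc' := congrFun hc a
      have hd' := congrFun hd a
      simp only [Pi.add_apply, Pi.sub_apply, Pi.smul_apply, smul_eq_mul] at hc' hd' ⊢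
      linear_combination hc' / 2 - Complex.I / 2 * hd' +
        ((T.block i j *ᵥ (v k).ofLp) a - (T.block j i *ᵥ (v k).ofLp) a) / 2 * Complex.I_sq
    have hone : star (v k).ofLp ⬝ᵥ (v k).ofLp = 1 := by
      have := inner_self_eq_one_of_norm_eq_one (𝕜 := ℂ) (v.norm_eq_one k)
      rwa [EuclideanSpace.inner_eq_star_dotProduct, dotProduct_comm] at this
    rw [he, dotProduct_smul, hone, smul_eq_mul, mul_one]
  refine ⟨n, fun k => Matrix.of fun i j => star (v k).ofLp ⬝ᵥ (T.block i j *ᵥ (v k).ofLp),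
    fun k => Matrix.vecMulVec (v k).ofLp (star (v k).ofLp),
    fun k => posSemidef_dotProduct_block_mulVec hT _,
    fun k => Matrix.posSemidef_vecMulVec_self_star _, ?_⟩
  have hblock (i j : Fin m) := Matrix.eq_sum_smul_vecMulVec_of_mulVec_eq v (heig i j)
  ext ⟨i, a⟩ ⟨j, b⟩
  have := congrFun (congrFun (hblock i j) a) b
  simpa [block, Matrix.sum_apply] using this

end BipartiteMatrix

theorem mainTheorem7 (m n : ℕ) (T : BipartiteMatrix m n) (hT : T.PosSemidef)
    (hrank : T.rank = T.marginalB.rank) :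
    T.IsSeparable ↔
      (∀ i j, IsStarNormal (T.filtered.block i j)) ∧
        (∀ i j k l, Commute (T.filtered.block i j) (T.filtered.block k l)) := by
  obtain ⟨R, S, P, hR, hRH, hSH, hPH, hPP, hRAR, hSR, hRS, hAP⟩ :=
    exists_filter_data (BipartiteMatrix.posSemidef_marginalB hT)
  have hfil : T.filtered = ((1 : Matrix (Fin m) (Fin m) ℂ) ⊗ₖ R) * T *
      ((1 : Matrix (Fin m) (Fin m) ℂ) ⊗ₖ R) := by
    rw [BipartiteMatrix.filtered, hR]
  have hWH : ((1 : Matrix (Fin m) (Fin m) ℂ) ⊗ₖ R)ᴴ = (1 : Matrix (Fin m) (Fin m) ℂ) ⊗ₖ R := by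
    rw [Matrix.conjTranspose_kronecker, hRH.eq, Matrix.conjTranspose_one]
  have hpos : T.filtered.PosSemidef := by
    have := hT.mul_mul_conjTranspose_same ((1 : Matrix (Fin m) (Fin m) ℂ) ⊗ₖ R)
    rwa [hWH, ← hfil] at this
  have hmarg : T.filtered.marginalB = P := by
    rw [hfil, BipartiteMatrix.marginalB_one_kronecker_mul_mul, hRAR]
  constructor
  · intro h
    have hsep : T.filtered.IsSeparable := by
      have := h.one_kronecker_mul_mul R
      rwa [hRH.eq, ← hfil] at this
    have hle : T.filtered.rank ≤ T.filtered.marginalB.rank := by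
      rw [hmarg]
      calc T.filtered.rank ≤ T.rank := by
            rw [hfil]
            exact (Matrix.rank_mul_le_left _ _).trans (Matrix.rank_mul_le_right _ _)
        _ = (T.marginalB * P).rank := by rw [hrank, hAP]
        _ ≤ P.rank := Matrix.rank_mul_le_right _ _
    have hcomm := BipartiteMatrix.commute_block_of_rank_le hsep (hmarg.symm ▸ hPP) hle
    exact ⟨BipartiteMatrix.isStarNormal_block_of_commute hpos.1 hcomm, hcomm⟩
  · rintro ⟨-, h⟩
    have hsep := (BipartiteMatrix.isSeparable_of_commute_block hpos h).one_kronecker_mul_mul S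
    -- Undoing the filter yields (I ⊗ P) T (I ⊗ P), so T must absorb I ⊗ P on both sides.
    have hTP := BipartiteMatrix.mul_one_kronecker_eq_self hT hPH hAP
    have hPT : ((1 : Matrix (Fin m) (Fin m) ℂ) ⊗ₖ P) * T = T := by
      have := congrArg Matrix.conjTranspose hTP
      rwa [Matrix.conjTranspose_mul, Matrix.conjTranspose_kronecker, hPH.eq, hT.1.eq,
        Matrix.conjTranspose_one] at this
    have hback : ((1 : Matrix (Fin m) (Fin m) ℂ) ⊗ₖ S) * T.filtered *
        ((1 : Matrix (Fin m) (Fin m) ℂ) ⊗ₖ Sᴴ) = T := by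
      rw [hfil, hSH.eq, ← mul_assoc, ← mul_assoc, ← Matrix.mul_kronecker_mul, mul_assoc,
        ← Matrix.mul_kronecker_mul, one_mul, hSR, hRS, hPT, hTP]
    rwa [hback] at hsep
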